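/- Let $1\le\alpha\le K$ and $f\ge 1$ be integers, with $f\ge K$ in the case $\alpha=K$. In the symmetric $(K,\alpha,f)$ file-demand-set (FDS) structure, a server holds a library of $N=f\binom{K}{\alpha}$ files $W_{i,\mathcal S}$, $i\in[f]$, $\mathcal S\subseteq[K]$, $|\mathcal S|=\alpha$, each of $B\ge 1$ bits. User $k\in[K]$ requests one file from its FDS $\mathcal F_k=\{W_{i,\mathcal S}:k\in\mathcal S\}$, which has $|\mathcal F|=f\binom{K-1}{\alpha-1}$ files. Before the requests are known, user $k$ stores at most $MB$ bits of the library, uncoded (a subset of the bits of the files) and selfishly (only bits of files in $\mathcal F_k$). After all requests are revealed, the server broadcasts bits computed from the library, and every user must recover its requested file from the broadcast and its own cached bits, for every content of the library. A pair $(M,R)$ is achievable if for some $B\ge 1$ there is such a scheme that broadcasts at most $RB$ bits for every valid demand (one in which each user requests a file of its own FDS), and $R^\star(M)=\inf\{R:(M,R)\text{ is achievable}\}$. Then, for every real $M\in[0,|\mathcal F|]$, $R^\star(M)\ge R_{\mathrm{LB}}(M)$, where $R_{\mathrm{LB}}$ is the piecewise-linear curve with corner points $$(M,R_{\mathrm{LB}})=\left(t\frac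 NK,\ \frac{\binom{\alpha}{t+1}+(K-\alpha)\binom{\alpha-1}{t}}{\binom{\alpha}{t}}\right),\qquad t\in\{0,1,\dots,\alpha\}.$$ With $\gamma=M/N$ and $\gamma_\alpha=M/|\mathcal F|=\gamma K/\alpha$, the value of $R_{\mathrm{LB}}$ at these corner points is $$R_{\mathrm{LB}}=\frac{K(1-\gamma_\alpha)}{K\gamma+1}\bigl[(K-\alpha)\gamma+1\bigr],$$ and the right-hand side is moreover a lower bound on $R^\star(M)$ for every real $M\in[0,|\mathcal F|]$. -/

import Mathlib

namespace SelfishCaching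

/-- A file `W_{i,S}` of the symmetric `(K, α, f)` file-demand-set structure: an index `i` in its
class together with the set `S` of the `α` users that are interested in the class. -/
abbrev File (K α f : ℕ) : Type := Fin f × {S : Finset (Fin K) // S.card = α}

/-- The file demand set of user `k`: all files whose class label contains `k`. -/
def fileDemandSet (K α f : ℕ) (k : Fin K) : Finset (File K α f) :=
  Finset.univ.filter fun w => k ∈ w.2.val

/-- A valid demand: every user requests one file of its own file demand set. -/
abbrev Demand (K α f : ℕ) : Type :=
  {d : Fin K → File K α f // ∀ k, d k ∈ fileDemandSet K α f k}

/-- A realization of the library: the `B` bits of every file. -/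
abbrev Library (K α f B : ℕ) : Type := File K α f → Fin B → Bool

/-- A caching-and-delivery scheme with uncoded placement for files of `B` bits. Before the demand
is known, user `k` stores the library bits at the positions `cache k`. Once the demand `d` is
revealed, the server broadcasts `length d` bits computed from the whole library by an arbitrary
function, and each user recovers its requested file, for every realization of the library, from
the broadcast and its own cached bits. -/
structure Scheme (K α f B : ℕ) where
  cache : Fin K → Finset (File K α f × Fin B)
  length : Demand K α f → ℕ
  encode : (d : Demand K α f) → Library K α f B → (Fin (length d) → Bool)
  decode : (d : Demand K α f) → (k : Fin K) → (Fin (length d) → Bool) →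
    ({p // p ∈ cache k} → Bool) → (Fin B → Bool)
  correct : ∀ (d : Demand K α f) (k : Fin K) (W : Library K α f B),
    decode d k (encode d W) (fun p => W p.val.1 p.val.2) = W (d.val k)

/-- The placement is selfish: each user stores only bits of files of its own file demand set. -/
def Scheme.IsSelfish {K α f B : ℕ} (s : Scheme K α f B) : Prop :=
  ∀ k, ∀ p ∈ s.cache k, p.1 ∈ fileDemandSet K α f k

/-- The pair `(M, R)` is achievable under uncoded and selfish placement: for some file size
`B ≥ 1` there is a selfish scheme whose caches hold at most `M * B` bits each and which transmits
at most `R * B` bits for every valid demand. -/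
def Achievable (K α f : ℕ) (M R : ℝ) : Prop :=
  ∃ B : ℕ, 0 < B ∧ ∃ s : Scheme K α f B, s.IsSelfish ∧
    (∀ k, ((s.cache k).card : ℝ) ≤ M * B) ∧ ∀ d, (s.length d : ℝ) ≤ R * B

/-- The optimal worst-case load `R⋆(M)` under uncoded and selfish placement. -/
noncomputable def optimalLoad (K α f : ℕ) (M : ℝ) : ℝ :=
  sInf {R : ℝ | Achievable K α f M R}

/-- The number `N` of files in the library. -/
def numFiles (K α f : ℕ) : ℕ := f * K.choose α

/-- The number `|F|` of files in the file demand set of a user. -/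
def fdsSize (K α f : ℕ) : ℕ := f * (K - 1).choose (α - 1)

/-- The load at the corner point with integer cache redundancy `t`. -/
noncomputable def cornerLoad (K α t : ℕ) : ℝ :=
  ((α.choose (t + 1) : ℝ) + ((K : ℝ) - α) * ((α - 1).choose t : ℝ)) / (α.choose t : ℝ)

/-- The piecewise-linear curve, as a function of `M`, through the corner points
`(t * N / K, cornerLoad K α t)`: with the cache redundancy `τ = K * M / N`, it interpolates
linearly between the corner points at `⌊τ⌋` and `⌊τ⌋ + 1`. It is used for `0 ≤ τ ≤ α`. -/
noncomputable def lowerBoundCurve (K α f : ℕ) (M : ℝ) : ℝ :=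
  let τ : ℝ := K * M / numFiles K α f
  (1 - (τ - ⌊τ⌋₊)) * cornerLoad K α ⌊τ⌋₊ + (τ - ⌊τ⌋₊) * cornerLoad K α (⌊τ⌋₊ + 1)

theorem card_file (K α f : ℕ) : Fintype.card (File K α f) = numFiles K α f := by
  simp [File, numFiles]

theorem card_fileDemandSet (K α f : ℕ) (hα : 1 ≤ α) (k : Fin K) :
    (fileDemandSet K α f k).card = fdsSize K α f := by
  have h1 : fdsSize K α f = ((Finset.univ : Finset (Fin f)) ×ˢ
      ((Finset.univ.erase k).powersetCard (α - 1))).card := by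
    simp [fdsSize]
  rw [h1]
  refine Finset.card_bij' (fun w _ => (w.1, w.2.val.erase k))
    (fun v hv => (v.1, ⟨insert k v.2, ?_⟩)) ?_ ?_ ?_ ?_
  · simp only [Finset.mem_product, Finset.mem_powersetCard] at hv
    rw [Finset.card_insert_of_notMem (fun h => by simpa using hv.2.1 h), hv.2.2]
    omega
  · rintro ⟨i, S, hS⟩ hw
    have hk : k ∈ S := by simpa [fileDemandSet] using hw
    simp only [Finset.mem_product, Finset.mem_univ, Finset.mem_powersetCard, true_and]
    exact ⟨Finset.erase_subset_erase _ (Finset.subset_univ _), by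
      rw [Finset.card_erase_of_mem hk, hS]⟩
  · intro v hv
    simp [fileDemandSet]
  · rintro ⟨i, S, hS⟩ hw
    have hk : k ∈ S := by simpa [fileDemandSet] using hw
    simp [Finset.insert_erase hk]
  · rintro ⟨i, T⟩ hv
    simp only [Finset.mem_product, Finset.mem_powersetCard] at hv
    have hk : k ∉ T := fun h => by simpa using hv.2.1 h
    simp [Finset.erase_insert hk]

/-- The loads in the definition of `optimalLoad` are bounded below. -/
theorem bddBelow_achievable (K α f : ℕ) (hf : 0 < f) (hα : 0 < α) (hαK : α ≤ K) (M : ℝ) :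
    BddBelow {R : ℝ | Achievable K α f M R} := by
  have hex : ∀ k : Fin K, ∃ w : File K α f, w ∈ fileDemandSet K α f k := by
    intro k
    obtain ⟨S, hS, -, hc⟩ := Finset.exists_subsuperset_card_eq
      (s := {k}) (t := (Finset.univ : Finset (Fin K))) (n := α) (by simp) (by rw [Finset.card_singleton]; exact hα)
      (by simpa using hαK)
    exact ⟨(⟨0, hf⟩, ⟨S, hc⟩), by simpa [fileDemandSet] using hS⟩
  choose d hd using hex
  refine ⟨0, ?_⟩
  rintro R ⟨B, hB, s, -, -, h⟩
  have h1 : (0 : ℝ) ≤ R * B := (Nat.cast_nonneg _).trans (h ⟨d, hd⟩)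
  exact nonneg_of_mul_nonneg_left h1 (by exact_mod_cast hB)

/-- Sending all requested files uncoded shows that some load is achievable. -/
theorem achievable_uncoded (K α f : ℕ) {M : ℝ} (hM : 0 ≤ M) : Achievable K α f M K := by
  refine ⟨1, one_pos, ⟨fun _ => ∅, fun _ => K, fun d W j => W (d.val j) 0,
    fun _ k x _ _ => x k, ?_⟩, ?_, ?_, ?_⟩
  · intro d k W
    funext b
    rw [Subsingleton.elim b 0]
  · intro k p hp
    simp at hp
  · intro k
    simpa using hM
  · intro d
    simp

end SelfishCaching

/-! Fix a demand and an order of the users. A decoder that runs through the users in this order,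
each time adding the recovered file to its knowledge, learns every requested bit that no user so far
has cached; hence the broadcast is at least as long as the number of such bits
(`card_acyclicSet_le`).

This bound is averaged over the demands in which user `u j` requests a file of the class `u {j, …, j
+ α - 1}` (indices mod `K`), for all orders `u` and all index shifts. By selfishness the set `T` of
users caching a bit lies inside its class, so the bit counts for `u j` as soon as `T` comes after
`j` without wrapping around. By symmetry the number of such `u` depends on `T` only through `t =
|T|` (`card_perm_image_mul`), and summing over `j` yields exactly the corner load at `t`. Thus the
mean corner load over all bits is at most the load (`sum_cornerLoad_le`).

The memory constraint says that the mean of `t` is at most `K * M / N`. The corner loads are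
decreasing and convex in `t`, so each chord through two consecutive corner points minorizes them and
passes to the mean. The closed form is a convex function through the same points, hence lies below
the chord of its own segment. -/

namespace SelfishCaching

/-! ### The acyclic (sequential decoding) bound -/

/-- The library positions that the users, in the order `u`, still have to learn from the
broadcast: position `(w, b)` is counted if `w` is requested by some user `u j` and the bit is
cached by none of the users up to `u j`. -/
noncomputable def acyclicSet {K α f B : ℕ} (s : Scheme K α f B) (d : Demand K α f)
    (u : Equiv.Perm (Fin K)) : Finset (File K α f × Fin B) :=
  open Classical in
  Finset.univ.filter fun p => ∃ j, p.1 = d.val (u j) ∧ ∀ i ≤ j, p ∉ s.cache (u i)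

theorem card_acyclicSet_le {K α f B : ℕ} (s : Scheme K α f B) (d : Demand K α f)
    (u : Equiv.Perm (Fin K)) : (acyclicSet s d u).card ≤ s.length d := by
  classical
  -- Free bits on the acyclic set, zeros elsewhere: the broadcast must tell these libraries apart.
  let W : (acyclicSet s d u → Bool) → Library K α f B := fun x w b =>
    if h : (w, b) ∈ acyclicSet s d u then x ⟨(w, b), h⟩ else false
  have hinj : Function.Injective fun x => s.encode d (W x) := by
    intro x y hxy
    have hfile : ∀ j, W x (d.val (u j)) = W y (d.val (u j)) := by
      intro j
      -- User `u j` sees equal caches for `x` and `y`: a cached bit of the acyclic set belongs to a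
      -- file requested by an earlier user, equal by induction, and any other bit is zero.
      induction j using WellFoundedLT.induction with
      | ind j ih =>
        rw [← s.correct d (u j) (W x), ← s.correct d (u j) (W y)]
        congr 1
        funext p
        obtain ⟨⟨w, b⟩, hp⟩ := p
        by_cases h : (w, b) ∈ acyclicSet s d u
        · obtain ⟨i, hi, hn⟩ := (Finset.mem_filter.1 h).2
          have hij : i < j := by
            by_contra hc
            exact hn j (not_lt.1 hc) hp
          have := ih i hij
          simp only at hi
          rw [← hi] at this
          exact congrFun this b
        · simp [W, h]
    funext ⟨⟨w, b⟩, h⟩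
    obtain ⟨i, hi, -⟩ := (Finset.mem_filter.1 h).2
    have := congrFun (hfile i) b
    simp only at hi
    rw [← hi] at this
    simpa [W, h] using this
  have := Fintype.card_le_of_injective _ hinj
  simp only [Fintype.card_fun, Fintype.card_bool, Fintype.card_coe, Fintype.card_fin] at this
  exact (Nat.pow_le_pow_iff_right (by norm_num)).1 this

/-! ### Counting permutations by symmetry -/

theorem exists_perm_comp_eq {V ι : Type*} [Fintype V] [DecidableEq ι] (g h : V → ι)
    (hc : ∀ i, Fintype.card {v // g v = i} = Fintype.card {v // h v = i}) :
    ∃ σ : Equiv.Perm V, ∀ v, h (σ v) = g v := by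
  let e : ∀ i, {v // g v = i} ≃ {v // h v = i} := fun i => Fintype.equivOfCardEq (hc i)
  refine ⟨(Equiv.sigmaFiberEquiv g).symm.trans ((Equiv.sigmaCongrRight e).trans
    (Equiv.sigmaFiberEquiv h)), fun v => ?_⟩
  exact (e (g v) ⟨v, rfl⟩).2

/-- Permutations act transitively on nested pairs of finite sets of given sizes. -/
theorem exists_perm_image_eq {V : Type*} [Fintype V] [DecidableEq V] {S T S' T' : Finset V}
    (hTS : T ⊆ S) (hTS' : T' ⊆ S') (hS : S.card = S'.card) (hT : T.card = T'.card) :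
    ∃ σ : Equiv.Perm V, S.image σ = S' ∧ T.image σ = T' := by
  obtain ⟨σ, hσ⟩ := exists_perm_comp_eq (fun v => (decide (v ∈ S), decide (v ∈ T)))
    (fun v => (decide (v ∈ S'), decide (v ∈ T'))) (by
      have hSc : Sᶜ.card = S'ᶜ.card := by rw [Finset.card_compl, Finset.card_compl, hS]
      have hST : (S \ T).card = (S' \ T').card := by
        rw [Finset.card_sdiff_of_subset hTS, Finset.card_sdiff_of_subset hTS', hS, hT]
      rintro ⟨a, b⟩
      rw [Fintype.card_subtype, Fintype.card_subtype]
      -- The four fibres are `Sᶜ`, the empty set (as `T ⊆ S`), `S \ T` and `T`.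
      cases a <;> cases b
      · convert hSc using 2 <;> ext v <;> simp <;> grind
      · convert (rfl : (0 : ℕ) = 0) using 1 <;> simp <;> grind
      · convert hST using 2 <;> ext v <;> simp
      · convert hT using 2 <;> ext v <;> simp <;> grind)
  have h1 : ∀ v, σ v ∈ S' ↔ v ∈ S := fun v => by simpa using congrArg Prod.fst (hσ v)
  have h2 : ∀ v, σ v ∈ T' ↔ v ∈ T := fun v => by simpa using congrArg Prod.snd (hσ v)
  refine ⟨σ, ?_, ?_⟩
  · ext v
    obtain ⟨x, rfl⟩ := σ.surjective v
    simp [h1]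
  · ext v
    obtain ⟨x, rfl⟩ := σ.surjective v
    simp [h2]

/-- The number of permutations that map `A` onto `S` and a subset `A'` of `A` onto a superset
of `T ⊆ S`. -/
theorem card_perm_image_mul {V : Type*} [Fintype V] [DecidableEq V] {A A' S T : Finset V}
    (hA : A' ⊆ A) (hTS : T ⊆ S) (hAS : A.card = S.card) :
    (Finset.univ.filter fun u : Equiv.Perm V => A.image u = S ∧ T ⊆ A'.image u).card *
      ((Fintype.card V).choose S.card * S.card.choose T.card) =
    (Fintype.card V).factorial * A'.card.choose T.card := by
  let n : Finset V → Finset V → ℕ := fun S T =>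
    (Finset.univ.filter fun u : Equiv.Perm V => A.image u = S ∧ T ⊆ A'.image u).card
  -- Left multiplication by a permutation taking `(S, T)` to `(S', T')` shows that the count depends
  -- only on the two sizes.
  have hconst : ∀ S' ∈ Finset.univ.powersetCard S.card, ∀ T' ∈ S'.powersetCard T.card,
      n S' T' = n S T := by
    intro S' hS' T' hT'
    rw [Finset.mem_powersetCard] at hS' hT'
    obtain ⟨σ, h1, h2⟩ := exists_perm_image_eq hTS hT'.1 hS'.2.symm hT'.2.symm
    symm
    refine Finset.card_bij' (fun u _ => σ * u) (fun u _ => σ⁻¹ * u) ?_ ?_ ?_ ?_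
    · intro u hu
      simp only [Finset.mem_filter, Finset.mem_univ, true_and] at hu ⊢
      rw [Equiv.Perm.coe_mul, ← Finset.image_image, ← Finset.image_image, hu.1, h1, ← h2]
      exact ⟨rfl, Finset.image_subset_image hu.2⟩
    · intro u hu
      simp only [Finset.mem_filter, Finset.mem_univ, true_and] at hu ⊢
      have hi : ∀ Z : Finset V, (Z.image σ).image (σ⁻¹ : Equiv.Perm V) = Z := by
        intro Z
        have h3 : ((σ⁻¹ : Equiv.Perm V) : V → V) ∘ σ = id := funext fun v => by simp
        rw [Finset.image_image, h3, Finset.image_id]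
      rw [Equiv.Perm.coe_mul, ← Finset.image_image, ← Finset.image_image, hu.1, ← h1, hi,
        ← hi T, h2]
      exact ⟨rfl, Finset.image_subset_image hu.2⟩
    · intro u _
      simp
    · intro u _
      simp
  -- Double counting: each `u` admits the single set `S' = u(A)`, and then `T'` is any subset of
  -- `u(A')` of the right size.
  have hsum : ∑ S' ∈ Finset.univ.powersetCard S.card, ∑ T' ∈ S'.powersetCard T.card, n S' T' =
      (Fintype.card V).factorial * A'.card.choose T.card := by
    simp only [n, Finset.card_filter]
    have hu : ∀ u : Equiv.Perm V, ∑ S' ∈ Finset.univ.powersetCard S.card,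
        ∑ T' ∈ S'.powersetCard T.card, (if A.image u = S' ∧ T' ⊆ A'.image u then 1 else 0) =
        A'.card.choose T.card := by
      intro u
      rw [Finset.sum_eq_single (A.image u)]
      · rw [← Finset.card_filter]
        have h3 : (Finset.filter (fun T' => A.image u = A.image u ∧ T' ⊆ A'.image u)
            ((A.image u).powersetCard T.card)) = (A'.image u).powersetCard T.card := by
          ext T'
          simp only [Finset.mem_filter, Finset.mem_powersetCard, true_and]
          constructor
          · rintro ⟨⟨_, h⟩, h'⟩
            exact ⟨h', h⟩
          · rintro ⟨h, h'⟩
            exact ⟨⟨h.trans (Finset.image_subset_image hA), h'⟩, h⟩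
        rw [h3, Finset.card_powersetCard, Finset.card_image_of_injective _ u.injective]
      · intro S' _ hne
        refine Finset.sum_eq_zero fun T' _ => ?_
        rw [if_neg fun h => hne h.1.symm]
      · intro h
        exact (h (Finset.mem_powersetCard.2 ⟨Finset.subset_univ _, by
          rw [Finset.card_image_of_injective _ u.injective, hAS]⟩)).elim
    rw [Finset.sum_congr rfl fun S' _ => Finset.sum_comm, Finset.sum_comm]
    rw [Finset.sum_congr rfl fun u _ => hu u]
    simp [Fintype.card_perm]
  rw [← hsum, Finset.sum_congr rfl fun S' hS' => Finset.sum_congr rfl (hconst S' hS')]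
  rw [Finset.sum_congr rfl fun S' hS' => by
    rw [Finset.sum_const, Finset.card_powersetCard, (Finset.mem_powersetCard.1 hS').2]]
  rw [Finset.sum_const, Finset.card_powersetCard, Finset.card_univ]
  simp only [smul_eq_mul, n]
  ring

/-! ### Cyclic intervals -/

/-- The cyclic interval of length `α` that starts at `j`. -/
def cyclicInterval (K α : ℕ) (j : Fin K) : Finset (Fin K) :=
  Finset.univ.filter fun x => (j.val ≤ x.val ∧ x.val < j.val + α) ∨ x.val + K < j.val + α

/-- The elements of the cyclic interval that come after `j`. -/
def cyclicIntervalAfter (K α : ℕ) (j : Fin K) : Finset (Fin K) :=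
  Finset.univ.filter fun x => j.val < x.val ∧ x.val < j.val + α

theorem card_filter_fin (K a b : ℕ) :
    (Finset.univ.filter fun x : Fin K => a ≤ x.val ∧ x.val < b).card = min b K - a := by
  rw [← Nat.card_Ico, ← Finset.card_map Fin.valEmbedding]
  congr 1
  ext y
  simp only [Finset.mem_map, Finset.mem_filter, Finset.mem_univ, true_and, Fin.valEmbedding_apply,
    Finset.mem_Ico, lt_min_iff]
  constructor
  · rintro ⟨x, h, rfl⟩
    exact ⟨h.1, h.2, x.isLt⟩
  · rintro ⟨h1, h2, h3⟩
    exact ⟨⟨y, h3⟩, ⟨h1, h2⟩, rfl⟩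

theorem card_cyclicInterval {K α : ℕ} (hαK : α ≤ K) (j : Fin K) :
    (cyclicInterval K α j).card = α := by
  have hj := j.isLt
  have h : cyclicInterval K α j =
      (Finset.univ.filter fun x : Fin K => j.val ≤ x.val ∧ x.val < j.val + α) ∪
        (Finset.univ.filter fun x : Fin K => 0 ≤ x.val ∧ x.val < j.val + α - K) := by
    ext x
    simp only [cyclicInterval, Finset.mem_filter, Finset.mem_univ, true_and, Finset.mem_union]
    omega
  rw [h, Finset.card_union_of_disjoint, card_filter_fin, card_filter_fin]
  · omega
  · rw [Finset.disjoint_filter]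
    intro x _
    omega

theorem card_cyclicIntervalAfter {K α : ℕ} (j : Fin K) :
    (cyclicIntervalAfter K α j).card = min (α - 1) (K - 1 - j.val) := by
  have h : cyclicIntervalAfter K α j =
      Finset.univ.filter fun x : Fin K => j.val + 1 ≤ x.val ∧ x.val < j.val + α := rfl
  rw [h, card_filter_fin]
  omega

theorem cyclicIntervalAfter_subset (K α : ℕ) (j : Fin K) :
    cyclicIntervalAfter K α j ⊆ cyclicInterval K α j := by
  intro x
  simp only [cyclicInterval, cyclicIntervalAfter, Finset.mem_filter, Finset.mem_univ, true_and]
  omega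

theorem self_mem_cyclicInterval {K α : ℕ} (hα : 1 ≤ α) (j : Fin K) : j ∈ cyclicInterval K α j := by
  simp only [cyclicInterval, Finset.mem_filter, Finset.mem_univ, true_and]
  omega

/-- For `α < K` the starting point is the only element of the interval whose cyclic predecessor lies
outside; for `α = K` every interval is everything. -/
theorem cyclicInterval_injective {K α : ℕ} (hα : 1 ≤ α) (hαK : α < K) :
    Function.Injective (cyclicInterval K α) := by
  have key : ∀ j l : Fin K, j < l → cyclicInterval K α j ≠ cyclicInterval K α l := by
    intro j l hjl h
    have hm : ∀ x : Fin K, _ ↔ _ := fun x => Finset.ext_iff.1 h x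
    simp only [cyclicInterval, Finset.mem_filter, Finset.mem_univ, true_and] at hm
    have hl := l.isLt
    have hjl' : j.val < l.val := hjl
    have h1 := hm j
    by_cases h0 : j.val = 0
    · have h2 := hm ⟨K - 1, by omega⟩
      simp only at h2
      omega
    · have h2 := hm ⟨j.val - 1, by omega⟩
      simp only at h2
      omega
  intro j l h
  rcases lt_trichotomy j l with hjl | hjl | hjl
  · exact (key j l hjl h).elim
  · exact hjl
  · exact (key l j hjl h.symm).elim

theorem sum_range_choose_eq (n t : ℕ) : ∑ x ∈ Finset.range n, x.choose t = n.choose (t + 1) := by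
  induction n with
  | zero => simp
  | succ n ih => rw [Finset.sum_range_succ, ih, Nat.choose_succ_succ, add_comm]

/-- The last `α` starting points have `0, …, α - 1` successors and give a hockey-stick sum; each of
the other `K - α` has the full `α - 1`. -/
theorem sum_choose_card_cyclicIntervalAfter {K α : ℕ} (hα : 1 ≤ α) (hαK : α ≤ K) (t : ℕ) :
    ∑ j : Fin K, (cyclicIntervalAfter K α j).card.choose t =
      α.choose (t + 1) + (K - α) * (α - 1).choose t := by
  simp only [card_cyclicIntervalAfter]
  rw [Fin.sum_univ_eq_sum_range (fun j => (min (α - 1) (K - 1 - j)).choose t) K,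
    Finset.sum_range_reflect (fun j => (min (α - 1) j).choose t) K]
  obtain ⟨m, rfl⟩ := Nat.exists_eq_add_of_le hαK
  rw [Finset.sum_range_add, ← sum_range_choose_eq]
  congr 1
  · refine Finset.sum_congr rfl fun x hx => ?_
    rw [Finset.mem_range] at hx
    rw [min_eq_right (by omega)]
  · rw [Finset.sum_congr rfl fun x _ => by rw [min_eq_left (by omega : α - 1 ≤ α + x)]]
    simp

/-! ### Cyclic demands and the averaged bound -/

/-- The demand in which the `j`-th user in the order `u` requests a file from the class of the
users that follow it cyclically; the file indices are shifted by `c`. -/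
def cyclicDemand {K α f : ℕ} [NeZero f] (hα : 1 ≤ α) (hαK : α ≤ K) (u : Equiv.Perm (Fin K))
    (c : Fin f) : Demand K α f :=
  ⟨fun k => (c + Fin.ofNat f (u.symm k).val, ⟨(cyclicInterval K α (u.symm k)).image u, by
    rw [Finset.card_image_of_injective _ u.injective, card_cyclicInterval hαK]⟩), fun k => by
    simp only [fileDemandSet, Finset.mem_filter, Finset.mem_univ, true_and, Finset.mem_image]
    exact ⟨u.symm k, self_mem_cyclicInterval hα _, by simp⟩⟩

/-- For `α < K` the classes already differ. For `α = K` there is one class only, and the indices `c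
+ j` differ mod `f` because `K ≤ f`. -/
theorem cyclicDemand_injective {K α f : ℕ} [NeZero f] (hα : 1 ≤ α) (hαK : α ≤ K)
    (hfK : α = K → K ≤ f) (u : Equiv.Perm (Fin K)) (c : Fin f) :
    Function.Injective (cyclicDemand hα hαK u c).val := by
  intro k l h
  apply u.symm.injective
  simp only [cyclicDemand, Prod.mk.injEq, Subtype.mk.injEq] at h
  rcases hαK.lt_or_eq with hlt | heq
  · exact cyclicInterval_injective hα hlt (Finset.image_injective u.injective h.2)
  · have h1 := congrArg Fin.val (add_left_cancel h.1)
    simp only [Fin.ofNat] at h1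
    have hK := hfK heq
    rw [Nat.mod_eq_of_lt (by omega), Nat.mod_eq_of_lt (by omega)] at h1
    exact Fin.ext h1

/-- The users that cache a library position. -/
def cachedBy {K α f B : ℕ} (s : Scheme K α f B) (p : File K α f × Fin B) : Finset (Fin K) :=
  Finset.univ.filter fun k => p ∈ s.cache k

theorem cachedBy_subset {K α f B : ℕ} {s : Scheme K α f B} (hs : s.IsSelfish)
    (p : File K α f × Fin B) : cachedBy s p ⊆ p.1.2.val := by
  intro k hk
  simp only [cachedBy, Finset.mem_filter, Finset.mem_univ, true_and] at hk
  simpa [fileDemandSet] using hs k p hk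

theorem sum_card_cachedBy {K α f B : ℕ} (s : Scheme K α f B) :
    ∑ p, (cachedBy s p).card = ∑ k, (s.cache k).card := by
  simp only [cachedBy, Finset.card_filter]
  rw [Finset.sum_comm]
  simp

/-- How often a library position lies in the acyclic sets of the cyclic demands. -/
theorem sum_card_le_card_mem_acyclicSet {K α f B : ℕ} [NeZero f] (hα : 1 ≤ α) (hαK : α ≤ K)
    (hfK : α = K → K ≤ f) (s : Scheme K α f B) (p : File K α f × Fin B) :
    ∑ j : Fin K, (Finset.univ.filter fun u : Equiv.Perm (Fin K) =>
      (cyclicInterval K α j).image u = p.1.2.val ∧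
        cachedBy s p ⊆ (cyclicIntervalAfter K α j).image u).card ≤
    (Finset.univ.filter fun v : Equiv.Perm (Fin K) × Fin f =>
      p ∈ acyclicSet s (cyclicDemand hα hαK v.1 v.2) v.1).card := by
  rw [← Finset.card_sigma]
  -- The shift `i - j` is the one for which user `u j` requests the file index `i` of `p`.
  refine Finset.card_le_card_of_injOn (fun x => (x.2, p.1.1 - Fin.ofNat f x.1.val)) ?_ ?_
  · rintro ⟨j, u⟩ hx
    simp only [Finset.coe_sigma, Set.mem_sigma_iff, Finset.mem_coe, Finset.mem_univ, true_and,
      Finset.mem_filter] at hx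
    simp only [Finset.mem_coe, Finset.mem_filter, Finset.mem_univ, true_and, acyclicSet]
    refine ⟨j, ?_, ?_⟩
    · refine Prod.ext ?_ (Subtype.ext ?_)
      · simp [cyclicDemand]
      · simpa [cyclicDemand] using hx.1.symm
    · intro i hi hp
      have h1 : u i ∈ cachedBy s p := by simpa [cachedBy] using hp
      obtain ⟨x, hx1, hx2⟩ := Finset.mem_image.1 (hx.2 h1)
      rw [u.injective hx2] at hx1
      simp only [cyclicIntervalAfter, Finset.mem_filter, Finset.mem_univ, true_and] at hx1
      have : i.val ≤ j.val := hi
      omega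
  · rintro ⟨j, u⟩ hx ⟨l, v⟩ hy h
    simp only [Finset.coe_sigma, Set.mem_sigma_iff, Finset.mem_coe, Finset.mem_univ, true_and,
      Finset.mem_filter] at hx hy
    simp only [Prod.mk.injEq] at h
    obtain ⟨rfl, hc⟩ := h
    -- Under the same `u` and shift, both `u j` and `u l` request the file of `p`; distinct requests
    -- then force `j = l`.
    have h1 : (cyclicDemand hα hαK u (p.1.1 - Fin.ofNat f j.val)).val (u j) =
        (cyclicDemand hα hαK u (p.1.1 - Fin.ofNat f j.val)).val (u l) := by
      refine Prod.ext ?_ (Subtype.ext ?_)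
      · rw [hc]
        simp only [cyclicDemand, Equiv.symm_apply_apply, sub_add_cancel]
        rw [← hc, sub_add_cancel]
      · simpa [cyclicDemand] using hx.1.trans hy.1.symm
    have h2 := u.injective (cyclicDemand_injective hα hαK hfK u _ h1)
    rw [h2]

theorem sum_card_perm_eq {K α t : ℕ} (hα : 1 ≤ α) (hαK : α ≤ K) {S T : Finset (Fin K)}
    (hTS : T ⊆ S) (hS : S.card = α) (hT : T.card = t) :
    ((∑ j : Fin K, (Finset.univ.filter fun u : Equiv.Perm (Fin K) =>
      (cyclicInterval K α j).image u = S ∧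
        T ⊆ (cyclicIntervalAfter K α j).image u).card : ℕ) : ℝ) * K.choose α =
    K.factorial * cornerLoad K α t := by
  have htα : t ≤ α := by rw [← hS, ← hT]; exact Finset.card_le_card hTS
  have h0 : (0 : ℝ) < α.choose t := by exact_mod_cast Nat.choose_pos htα
  have h1 : (∑ j : Fin K, (Finset.univ.filter fun u : Equiv.Perm (Fin K) =>
      (cyclicInterval K α j).image u = S ∧
        T ⊆ (cyclicIntervalAfter K α j).image u).card) * (K.choose α * α.choose t) =
      K.factorial * (α.choose (t + 1) + (K - α) * (α - 1).choose t) := by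
    rw [← sum_choose_card_cyclicIntervalAfter hα hαK, Finset.mul_sum, Finset.sum_mul]
    refine Finset.sum_congr rfl fun j _ => ?_
    have := card_perm_image_mul (cyclicIntervalAfter_subset K α j) hTS
      (by rw [card_cyclicInterval hαK, hS])
    rwa [Fintype.card_fin, hS, hT] at this
  have h2 := congrArg (Nat.cast (R := ℝ)) h1
  rw [cornerLoad, ← mul_div_assoc, eq_div_iff h0.ne']
  rw [Nat.cast_mul, Nat.cast_mul, Nat.cast_mul, Nat.cast_add, Nat.cast_mul,
    Nat.cast_sub hαK] at h2
  rw [← h2]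
  ring

/-- The average of the acyclic bounds over all cyclic demands. -/
theorem sum_cornerLoad_le {K α f B : ℕ} (hα : 1 ≤ α) (hαK : α ≤ K) (hf : 1 ≤ f)
    (hfK : α = K → K ≤ f) {s : Scheme K α f B} (hs : s.IsSelfish) {L : ℝ}
    (hL : ∀ d, (s.length d : ℝ) ≤ L) :
    ∑ p, cornerLoad K α (cachedBy s p).card ≤ numFiles K α f * L := by
  classical
  have : NeZero f := ⟨by omega⟩
  have hC : (0 : ℝ) < K.choose α := by exact_mod_cast Nat.choose_pos hαK
  have hF : (0 : ℝ) < K.factorial := by exact_mod_cast K.factorial_pos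
  have h1 : ∀ p : File K α f × Fin B, K.factorial * cornerLoad K α (cachedBy s p).card ≤
      ((Finset.univ.filter fun v : Equiv.Perm (Fin K) × Fin f =>
        p ∈ acyclicSet s (cyclicDemand hα hαK v.1 v.2) v.1).card : ℝ) * K.choose α := by
    intro p
    rw [← sum_card_perm_eq hα hαK (cachedBy_subset hs p) p.1.2.2 rfl]
    gcongr
    exact sum_card_le_card_mem_acyclicSet hα hαK hfK s p
  have h2 : ((∑ p, (Finset.univ.filter fun v : Equiv.Perm (Fin K) × Fin f =>
        p ∈ acyclicSet s (cyclicDemand hα hαK v.1 v.2) v.1).card : ℕ) : ℝ) ≤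
      K.factorial * f * L := by
    have h3 : (∑ p, (Finset.univ.filter fun v : Equiv.Perm (Fin K) × Fin f =>
        p ∈ acyclicSet s (cyclicDemand hα hαK v.1 v.2) v.1).card) =
        ∑ v : Equiv.Perm (Fin K) × Fin f,
          (acyclicSet s (cyclicDemand hα hαK v.1 v.2) v.1).card := by
      simp only [Finset.card_filter]
      rw [Finset.sum_comm]
      simp
    rw [h3, Nat.cast_sum]
    calc _ ≤ ∑ _v : Equiv.Perm (Fin K) × Fin f, L := Finset.sum_le_sum fun v _ =>
          (Nat.cast_le.2 (card_acyclicSet_le s _ v.1)).trans (hL _)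
      _ = _ := by simp [Fintype.card_perm]
  have h4 : K.factorial * ∑ p, cornerLoad K α (cachedBy s p).card ≤
      K.factorial * (numFiles K α f * L) := by
    rw [Finset.mul_sum]
    calc _ ≤ ∑ p : File K α f × Fin B, _ := Finset.sum_le_sum fun p _ => h1 p
      _ = ((∑ p, (Finset.univ.filter fun v : Equiv.Perm (Fin K) × Fin f =>
        p ∈ acyclicSet s (cyclicDemand hα hαK v.1 v.2) v.1).card : ℕ) : ℝ) * K.choose α := by
          rw [Nat.cast_sum, Finset.sum_mul]
      _ ≤ K.factorial * f * L * K.choose α := by gcongr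
      _ = _ := by rw [numFiles]; push_cast; ring
  exact le_of_mul_le_mul_left h4 hF

/-! ### From the average to the optimal load -/

/-- A decreasing affine minorant of the corner loads bounds every achievable load. -/
theorem affine_le_of_achievable {K α f : ℕ} (hα : 1 ≤ α) (hαK : α ≤ K) (hf : 1 ≤ f)
    (hfK : α = K → K ≤ f) {M R a b : ℝ} (hR : Achievable K α f M R) (hb : 0 ≤ b)
    (hab : ∀ t : ℕ, t ≤ α → a - b * t ≤ cornerLoad K α t) :
    a - b * (K * M / numFiles K α f) ≤ R := by
  obtain ⟨B, hB, s, hs, hM, hL⟩ := hR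
  have hN : (0 : ℝ) < numFiles K α f := by
    exact_mod_cast Nat.mul_pos hf (Nat.choose_pos hαK)
  have hB' : (0 : ℝ) < B := by exact_mod_cast hB
  have h1 := sum_cornerLoad_le hα hαK hf hfK hs hL
  have h2 : ∑ p, (a - b * ((cachedBy s p).card : ℝ)) ≤ ∑ p, cornerLoad K α (cachedBy s p).card :=
    Finset.sum_le_sum fun p _ => hab _
      ((Finset.card_le_card (cachedBy_subset hs p)).trans_eq p.1.2.2)
  have h3 : ((∑ p, (cachedBy s p).card : ℕ) : ℝ) ≤ K * (M * B) := by
    rw [sum_card_cachedBy, Nat.cast_sum]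
    calc _ ≤ ∑ _k : Fin K, M * B := Finset.sum_le_sum fun k _ => hM k
      _ = _ := by simp
  rw [Finset.sum_sub_distrib, ← Finset.mul_sum, ← Nat.cast_sum, Finset.sum_const,
    Finset.card_univ, Fintype.card_prod, card_file, Fintype.card_fin, nsmul_eq_mul,
    Nat.cast_mul] at h2
  -- The caches bound the total redundancy only from above, hence the need for `0 ≤ b`.
  have h4 := mul_le_mul_of_nonneg_left h3 hb
  have h5 : (numFiles K α f * B : ℝ) * (a - b * (K * M / numFiles K α f)) ≤
      (numFiles K α f * B : ℝ) * R := by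
    have : (numFiles K α f * B : ℝ) * (a - b * (K * M / numFiles K α f)) =
        numFiles K α f * B * a - b * (K * (M * B)) := by
      field_simp
    rw [this]
    linarith
  exact le_of_mul_le_mul_left h5 (by positivity)

theorem affine_le_optimalLoad {K α f : ℕ} (hα : 1 ≤ α) (hαK : α ≤ K) (hf : 1 ≤ f)
    (hfK : α = K → K ≤ f) {M a b : ℝ} (hM : 0 ≤ M) (hb : 0 ≤ b)
    (hab : ∀ t : ℕ, t ≤ α → a - b * t ≤ cornerLoad K α t) :
    a - b * (K * M / numFiles K α f) ≤ optimalLoad K α f M :=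
  le_csInf ⟨K, achievable_uncoded K α f hM⟩ fun _ hR =>
    affine_le_of_achievable hα hαK hf hfK hR hb hab

/-! ### Closed form and chords -/

theorem cornerLoad_eq {K α t : ℕ} (hα : 1 ≤ α) (ht : t ≤ α) :
    cornerLoad K α t = ((α : ℝ) - t) / (t + 1) + ((K : ℝ) - α) * (α - t) / α := by
  have h0 : (0 : ℝ) < α.choose t := by exact_mod_cast Nat.choose_pos ht
  have hα' : (0 : ℝ) < α := by exact_mod_cast hα
  have h1 : (α.choose (t + 1) : ℝ) * (t + 1) = α.choose t * (α - t) := by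
    have := congrArg (Nat.cast (R := ℝ)) (Nat.choose_succ_right_eq α t)
    rw [Nat.cast_mul, Nat.cast_mul, Nat.cast_sub ht] at this
    exact_mod_cast this
  have h2 : ((α - 1).choose t : ℝ) * α = α.choose t * (α - t) := by
    obtain ⟨m, rfl⟩ := Nat.exists_eq_add_of_le' hα
    have := congrArg (Nat.cast (R := ℝ)) (Nat.choose_mul_succ_eq m t)
    rw [Nat.cast_mul, Nat.cast_mul, Nat.cast_sub ht] at this
    simpa using this
  have h3 : (α.choose (t + 1) : ℝ) = α.choose t * (α - t) / (t + 1) := by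
    rw [eq_div_iff (by positivity), h1]
  have h4 : ((α - 1).choose t : ℝ) = α.choose t * (α - t) / α := by
    rw [eq_div_iff hα'.ne', h2]
  rw [cornerLoad, h3, h4]
  field_simp

theorem mul_numFiles_eq {K α f : ℕ} (hα : 1 ≤ α) (hαK : α ≤ K) :
    (α : ℝ) * numFiles K α f = K * fdsSize K α f := by
  obtain ⟨m, rfl⟩ := Nat.exists_eq_add_of_le' hα
  obtain ⟨k, rfl⟩ := Nat.exists_eq_add_of_le' (hα.trans hαK)
  have := Nat.add_one_mul_choose_eq k m
  simp only [numFiles, fdsSize, Nat.add_sub_cancel]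
  have h2 : ((k + 1 : ℕ) : ℝ) * k.choose m = (k + 1).choose (m + 1) * ((m + 1 : ℕ) : ℝ) := by
    exact_mod_cast this
  rw [Nat.cast_mul, Nat.cast_mul]
  linear_combination (-(f : ℝ)) * h2

/-- The closed form of the corner loads, extended to real cache redundancy. -/
noncomputable def smoothLoad (K α : ℕ) (x : ℝ) : ℝ :=
  ((α : ℝ) - x) / (x + 1) + ((K : ℝ) - α) * (α - x) / α

theorem closedForm_eq_smoothLoad {K α f : ℕ} (hα : 1 ≤ α) (hαK : α ≤ K) (hf : 1 ≤ f) {M : ℝ}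
    (hM : 0 ≤ M) :
    K * (1 - M / fdsSize K α f) / (K * (M / numFiles K α f) + 1) *
      (((K : ℝ) - α) * (M / numFiles K α f) + 1) =
    smoothLoad K α (K * M / numFiles K α f) := by
  have hN : (0 : ℝ) < numFiles K α f := by
    exact_mod_cast Nat.mul_pos hf (Nat.choose_pos hαK)
  have hα' : (0 : ℝ) < α := by exact_mod_cast hα
  have hK : (0 : ℝ) < K := by exact_mod_cast hα.trans hαK
  have hF : (fdsSize K α f : ℝ) = α * numFiles K α f / K := by
    rw [mul_numFiles_eq hα hαK]
    field_simp
  have h1 : (0 : ℝ) < K * M + numFiles K α f := by positivity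
  rw [hF, smoothLoad]
  field_simp
  ring

/-- The chord of `smoothLoad` through `n` and `n + 1`. -/
noncomputable def chord (K α n : ℕ) (x : ℝ) : ℝ :=
  (1 - (x - n)) * smoothLoad K α n + (x - n) * smoothLoad K α (n + 1)

/-- Only the part `(α + 1) / (x + 1)` of `smoothLoad` is not affine. The sign of `(x - n) * (x - n -
1)` serves twice: nonnegative at every integer, so chords minorize the corner loads; nonpositive on
`[n, n + 1]`, so there the closed form is below the chord. -/
theorem smoothLoad_sub_chord {K α n : ℕ} {x : ℝ} (hx : 0 ≤ x) :
    smoothLoad K α x - chord K α n x =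
      (α + 1) * ((x - n) * (x - n - 1)) / ((x + 1) * (n + 1) * (n + 2)) := by
  have h1 : (n : ℝ) + 1 + 1 ≠ 0 := by positivity
  have h2 : (n : ℝ) + 2 ≠ 0 := by positivity
  have h3 : (n : ℝ) + 1 ≠ 0 := by positivity
  have h4 : x + 1 ≠ 0 := by positivity
  have e : (n : ℝ) + 1 + 1 = n + 2 := by ring
  rw [chord, smoothLoad, smoothLoad, smoothLoad, e]
  field_simp
  ring

theorem chord_eq_affine {K α n : ℕ} (hα : 1 ≤ α) (hαK : α ≤ K) :
    ∃ a b : ℝ, 0 ≤ b ∧ ∀ x, chord K α n x = a - b * x := by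
  have hα' : (0 : ℝ) < α := by exact_mod_cast hα
  have hK : (0 : ℝ) ≤ (K : ℝ) - α := sub_nonneg.2 (by exact_mod_cast hαK)
  -- The slope `b` is the drop `smoothLoad K α n - smoothLoad K α (n + 1)`.
  refine ⟨(1 + n) * smoothLoad K α n - n * smoothLoad K α (n + 1),
    (α + 1) / ((n + 1) * (n + 2)) + ((K : ℝ) - α) / α, by positivity, fun x => ?_⟩
  have h2 : (n : ℝ) + 2 ≠ 0 := by positivity
  have h3 : (n : ℝ) + 1 ≠ 0 := by positivity
  have e : (n : ℝ) + 1 + 1 = n + 2 := by ring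
  rw [chord, smoothLoad, smoothLoad, e]
  field_simp
  ring

theorem chord_le_optimalLoad {K α f : ℕ} (hα : 1 ≤ α) (hαK : α ≤ K) (hf : 1 ≤ f)
    (hfK : α = K → K ≤ f) {M : ℝ} (hM : 0 ≤ M) (n : ℕ) :
    chord K α n (K * M / numFiles K α f) ≤ optimalLoad K α f M := by
  obtain ⟨a, b, hb, h⟩ := chord_eq_affine (n := n) hα hαK
  rw [h]
  refine affine_le_optimalLoad hα hαK hf hfK hM hb fun t ht => ?_
  rw [← h, cornerLoad_eq hα ht]
  change _ ≤ smoothLoad K α t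
  rw [← sub_nonneg, smoothLoad_sub_chord t.cast_nonneg]
  have : (0 : ℝ) ≤ ((t : ℝ) - n) * (t - n - 1) := by
    rcases le_or_gt t n with h1 | h1
    · have : (t : ℝ) ≤ n := by exact_mod_cast h1
      exact mul_nonneg_of_nonpos_of_nonpos (by linarith) (by linarith)
    · have : (n : ℝ) + 1 ≤ t := by exact_mod_cast h1
      exact mul_nonneg (by linarith) (by linarith)
  positivity

theorem smoothLoad_le_chord_floor {K α : ℕ} {x : ℝ} (hx : 0 ≤ x) :
    smoothLoad K α x ≤ chord K α ⌊x⌋₊ x := by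
  rw [← sub_nonpos, smoothLoad_sub_chord hx]
  have h1 := Nat.floor_le hx
  have h2 := Nat.lt_floor_add_one x
  have : (x - ⌊x⌋₊) * (x - ⌊x⌋₊ - 1) ≤ 0 :=
    mul_nonpos_of_nonneg_of_nonpos (by linarith) (by linarith)
  exact div_nonpos_of_nonpos_of_nonneg
    (mul_nonpos_of_nonneg_of_nonpos (by positivity) this) (by positivity)

theorem redundancy_le {K α f : ℕ} (hα : 1 ≤ α) (hαK : α ≤ K) (hf : 1 ≤ f) {M : ℝ}
    (hM : M ≤ fdsSize K α f) : K * M / numFiles K α f ≤ α := by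
  have hN : (0 : ℝ) < numFiles K α f := by
    exact_mod_cast Nat.mul_pos hf (Nat.choose_pos hαK)
  rw [div_le_iff₀ hN, mul_numFiles_eq hα hαK]
  gcongr

/-! ### The piecewise-linear curve -/

theorem lowerBoundCurve_eq_chord {K α f : ℕ} (hα : 1 ≤ α) (hαK : α ≤ K) (hf : 1 ≤ f) {M : ℝ}
    (hM : 0 ≤ M) (hM' : M ≤ fdsSize K α f) :
    lowerBoundCurve K α f M =
      chord K α ⌊K * M / numFiles K α f⌋₊ (K * M / numFiles K α f) := by
  have hx : 0 ≤ K * M / numFiles K α f := by positivity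
  have hxα := redundancy_le hα hαK hf hM'
  simp only [lowerBoundCurve]
  generalize K * M / numFiles K α f = x at hx hxα
  have hn : ⌊x⌋₊ ≤ α := Nat.floor_le_of_le hxα
  rw [chord, cornerLoad_eq hα hn]
  rcases hn.lt_or_eq with h | h
  · rw [cornerLoad_eq hα h, smoothLoad, smoothLoad]
    push_cast
    rfl
  -- At the right end `x = α` the curve refers to `cornerLoad K α (α + 1)`, a division by zero, but
  -- with weight `0`.
  · have h1 := Nat.floor_le hx
    rw [h] at h1 ⊢
    have : x = α := le_antisymm hxα h1
    simp [this, smoothLoad]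

theorem lowerBoundCurve_corner {K α f : ℕ} (hα : 1 ≤ α) (hαK : α ≤ K) (hf : 1 ≤ f) (t : ℕ) :
    lowerBoundCurve K α f (t * (numFiles K α f : ℝ) / K) = cornerLoad K α t := by
  have hN : (0 : ℝ) < numFiles K α f := by
    exact_mod_cast Nat.mul_pos hf (Nat.choose_pos hαK)
  have hK : (0 : ℝ) < K := by exact_mod_cast hα.trans hαK
  have h1 : K * (t * (numFiles K α f : ℝ) / K) / numFiles K α f = t := by field_simp
  simp [lowerBoundCurve, h1]

theorem lowerBoundCurve_segment {K α f : ℕ} (hα : 1 ≤ α) (hαK : α ≤ K) (hf : 1 ≤ f) (t : ℕ)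
    {θ : ℝ} (h0 : 0 ≤ θ) (h1 : θ ≤ 1) :
    lowerBoundCurve K α f ((t + θ) * (numFiles K α f : ℝ) / K) =
      (1 - θ) * cornerLoad K α t + θ * cornerLoad K α (t + 1) := by
  -- At `θ = 1` the floor jumps to `t + 1`, so this endpoint is treated as a corner point.
  rcases h1.lt_or_eq with h | rfl
  · have hN : (0 : ℝ) < numFiles K α f := by
      exact_mod_cast Nat.mul_pos hf (Nat.choose_pos hαK)
    have hK : (0 : ℝ) < K := by exact_mod_cast hα.trans hαK
    have h2 : K * ((t + θ) * (numFiles K α f : ℝ) / K) / numFiles K α f = t + θ := by field_simp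
    have h3 : ⌊(t : ℝ) + θ⌋₊ = t := by
      rw [Nat.floor_eq_iff (by positivity)]
      exact ⟨by linarith, by linarith⟩
    simp [lowerBoundCurve, h2, h3]
  · have := lowerBoundCurve_corner (f := f) hα hαK hf (t + 1)
    push_cast at this
    rw [this]
    ring

end SelfishCaching

theorem theorem1 (K α f : ℕ) (hα : 1 ≤ α) (hαK : α ≤ K) (hf : 1 ≤ f)
    (hfK : α = K → K ≤ f) :
    -- the optimal load is at least the piecewise-linear curve, on the whole memory range
    (∀ M : ℝ, 0 ≤ M → M ≤ SelfishCaching.fdsSize K α f →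
      SelfishCaching.lowerBoundCurve K α f M ≤ SelfishCaching.optimalLoad K α f M) ∧
    -- the corner points of the curve, with their closed form, where `γ = M / N`, `γα = M / |F|`
    (∀ t : ℕ, t ≤ α → ∀ M γ γα : ℝ,
      M = t * (SelfishCaching.numFiles K α f : ℝ) / K →
      γ = M / SelfishCaching.numFiles K α f →
      γα = M / SelfishCaching.fdsSize K α f →
      SelfishCaching.lowerBoundCurve K α f M =
        ((α.choose (t + 1) : ℝ) + ((K : ℝ) - α) * ((α - 1).choose t : ℝ)) / (α.choose t : ℝ) ∧
      SelfishCaching.lowerBoundCurve K α f M =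
        K * (1 - γα) / (K * γ + 1) * (((K : ℝ) - α) * γ + 1)) ∧
    -- the curve is affine between consecutive corner points
    (∀ t : ℕ, t < α → ∀ θ : ℝ, 0 ≤ θ → θ ≤ 1 →
      SelfishCaching.lowerBoundCurve K α f
          ((t + θ) * (SelfishCaching.numFiles K α f : ℝ) / K) =
        (1 - θ) * SelfishCaching.cornerLoad K α t + θ * SelfishCaching.cornerLoad K α (t + 1)) ∧
    -- the closed form is a lower bound on the optimal load on the whole memory range
    (∀ M γ γα : ℝ, 0 ≤ M → M ≤ SelfishCaching.fdsSize K α f →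
      γ = M / SelfishCaching.numFiles K α f →
      γα = M / SelfishCaching.fdsSize K α f →
      K * (1 - γα) / (K * γ + 1) * (((K : ℝ) - α) * γ + 1) ≤
        SelfishCaching.optimalLoad K α f M) := by
  have hN : (0 : ℝ) < SelfishCaching.numFiles K α f := by
    exact_mod_cast Nat.mul_pos hf (Nat.choose_pos hαK)
  have hK : (0 : ℝ) < K := by exact_mod_cast hα.trans hαK
  refine ⟨fun M hM hM' => ?_, fun t ht M γ γα h1 h2 h3 => ?_, fun t _ θ h0 h1 => ?_,
    fun M γ γα hM hM' h2 h3 => ?_⟩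
  · rw [SelfishCaching.lowerBoundCurve_eq_chord hα hαK hf hM hM']
    exact SelfishCaching.chord_le_optimalLoad hα hαK hf hfK hM _
  · have hM : 0 ≤ M := by rw [h1]; positivity
    have hτ : K * M / SelfishCaching.numFiles K α f = t := by rw [h1]; field_simp
    have hc : SelfishCaching.lowerBoundCurve K α f M = SelfishCaching.cornerLoad K α t := by
      rw [h1, SelfishCaching.lowerBoundCurve_corner hα hαK hf]
    refine ⟨hc, ?_⟩
    rw [hc, h2, h3, SelfishCaching.closedForm_eq_smoothLoad hα hαK hf hM, hτ, SelfishCaching.cornerLoad_eq hα ht]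
    rfl
  · exact SelfishCaching.lowerBoundCurve_segment hα hαK hf t h0 h1
  · rw [h2, h3, SelfishCaching.closedForm_eq_smoothLoad hα hαK hf hM]
    exact (SelfishCaching.smoothLoad_le_chord_floor (by positivity)).trans
      (SelfishCaching.chord_le_optimalLoad hα hαK hf hfK hM _)
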